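/- Let $d,m\in\mathbb N$, $p>1$ and $r>0$. For an open set $A\subset\mathbb R^d$, $\varepsilon>0$ and $u\in L^p(A;\mathbb R^m)$ set $$G^r_\varepsilon(u,A):=\int_{B_r}\int_{\{x\in A\,:\,x+\varepsilon\xi\in A\}}\Bigl|\frac{u(x+\varepsilon\xi)-u(x)}{\varepsilon}\Bigr|^p\,dx\,d\xi ,$$ where $B_r$ is the open ball of radius $r$ centred at the origin of $\mathbb R^d$, and write $u_E:=\frac1{|E|}\int_E u\,dx$ for the average of $u$ on a measurable set $E$ of positive measure. Let $A\subset\mathbb R^d$ be a bounded connected open set with Lipschitz boundary. Then for every measurable set $E\subset A$ with $|E|>0$ there exists a constant $C>0$, depending only on $A$, $E$ and the fixed parameters $d,m,p,r$, such that $$\int_A|u(x)-u_E|^p\,dx\le C\,G^r_\varepsilon(u,A)$$ for all $u\in L^p(A;\mathbb R^m)$ and all $\varepsilon\in(0,1)$. -/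

import Mathlib

open MeasureTheory
open scoped NNReal ENNReal

/-- `A ⊆ ℝ^d` has Lipschitz boundary: near each boundary point, for a suitable choice of the
vertical direction `n`, the set `A` is exactly the region lying strictly above the graph of a
Lipschitz function of the horizontal component `x - ⟪n, x⟫ n`. -/
def HasLipschitzBoundary {d : ℕ} (A : Set (EuclideanSpace ℝ (Fin d))) : Prop :=
  ∀ x₀ ∈ frontier A, ∃ n : EuclideanSpace ℝ (Fin d), ‖n‖ = 1 ∧
    ∃ (K : ℝ≥0) (γ : EuclideanSpace ℝ (Fin d) → ℝ), LipschitzWith K γ ∧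
      ∃ U : Set (EuclideanSpace ℝ (Fin d)), IsOpen U ∧ x₀ ∈ U ∧
        ∀ x ∈ U, x ∈ A ↔ γ (x - inner ℝ n x • n) < inner ℝ n x

/-- `A_ε(ξ) = {x ∈ A | x + ε ξ ∈ A}`. -/
def shiftDomain {d : ℕ} (A : Set (EuclideanSpace ℝ (Fin d))) (ε : ℝ)
    (ξ : EuclideanSpace ℝ (Fin d)) : Set (EuclideanSpace ℝ (Fin d)) :=
  {x | x ∈ A ∧ x + ε • ξ ∈ A}

/-- The localized convolution functional with exponent `p` and kernel `a`,
`G_ε[a](u, A) = ∫_{ℝ^d} a(ξ) ∫_{A_ε(ξ)} |(u(x + ε ξ) - u(x)) / ε|^p dx dξ`,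
with values in `[0, +∞]`. -/
noncomputable def convFunctional {d m : ℕ} (p : ℝ) (a : EuclideanSpace ℝ (Fin d) → ℝ≥0) (ε : ℝ)
    (u : EuclideanSpace ℝ (Fin d) → EuclideanSpace ℝ (Fin m))
    (A : Set (EuclideanSpace ℝ (Fin d))) : ℝ≥0∞ :=
  ∫⁻ ξ, (a ξ : ℝ≥0∞) *
    ∫⁻ x in shiftDomain A ε ξ, ‖ε⁻¹ • (u (x + ε • ξ) - u x)‖ₑ ^ p

/-- `G^r_ε(u, A)`: the convolution functional whose kernel is the characteristic function of the
open ball of radius `r` centred at the origin. -/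
noncomputable def ballConvFunctional {d m : ℕ} (p r ε : ℝ)
    (u : EuclideanSpace ℝ (Fin d) → EuclideanSpace ℝ (Fin m))
    (A : Set (EuclideanSpace ℝ (Fin d))) : ℝ≥0∞ :=
  convFunctional p (Set.indicator (Metric.ball 0 r) 1) ε u A

theorem ballConvFunctional_eq {d m : ℕ} (p r ε : ℝ)
    (u : EuclideanSpace ℝ (Fin d) → EuclideanSpace ℝ (Fin m))
    (A : Set (EuclideanSpace ℝ (Fin d))) :
    ballConvFunctional p r ε u A = ∫⁻ ξ in Metric.ball 0 r,
      ∫⁻ x in shiftDomain A ε ξ, ‖ε⁻¹ • (u (x + ε • ξ) - u x)‖ₑ ^ p := by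
  rw [← lintegral_indicator Metric.isOpen_ball.measurableSet]
  unfold ballConvFunctional convFunctional
  congr 1
  ext ξ
  by_cases h : ξ ∈ Metric.ball (0 : EuclideanSpace ℝ (Fin d)) r
  · rw [Set.indicator_of_mem h, Set.indicator_of_mem h]
    simp
  · rw [Set.indicator_of_notMem h, Set.indicator_of_notMem h]
    simp

/-! By Jensen, `|u x - u_E| ^ p` is at most the mean over `E` of `|u x - u y| ^ p`, so it suffices
to bound the double integral over `A × A`, that is, to prove `PairControl m p r A A A`. If all
segments from `S` to `T` lie in `A`, cut each into `N ~ 1/ε` equal pieces, short enough to be seen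
by the kernel. The power mean inequality and the change of variables `y = x + Nεξ` produce the
factor `(Nε) ^ (p + d)`, which stays bounded (`PairControl.of_segment_subset`). Control passes to
finite unions and chains through any intermediate set of positive measure (`PairControl.trans`).
Connectedness links small balls inside `A`; the Lipschitz boundary and compactness of `closure A`
cover `A` by finitely many pieces, each visible from a ball in `A`. -/

/-- The integral of `‖u x - u y‖ ^ p` over `S × T` is bounded by a constant multiple of the
convolution functional of `u` on `A`, uniformly in `u` and in the scale `ε ∈ (0, 1)`. -/
def PairControl {d : ℕ} (m : ℕ) (p r : ℝ) (A S T : Set (EuclideanSpace ℝ (Fin d))) : Prop :=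
  ∃ C : ℝ≥0, ∀ u : EuclideanSpace ℝ (Fin d) → EuclideanSpace ℝ (Fin m), Measurable u →
    ∀ ε : ℝ, 0 < ε → ε < 1 →
      ∫⁻ x in S, ∫⁻ y in T, ‖u x - u y‖ₑ ^ p ≤ C * ballConvFunctional p r ε u A

/-! ### Subdivision of segments. -/

theorem lintegral_eq_ofReal_pow_mul_lintegral_add_smul {d : ℕ} {s : ℝ} (hs : 0 < s)
    (x : EuclideanSpace ℝ (Fin d)) {g : EuclideanSpace ℝ (Fin d) → ℝ≥0∞} (hg : Measurable g) :
    ∫⁻ y, g y = ENNReal.ofReal s ^ d * ∫⁻ ξ, g (x + s • ξ) := by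
  have h1 : ∫⁻ ξ, g (x + s • ξ) = ∫⁻ z, g (x + z) ∂(Measure.map (s • ·) volume) := by
    rw [lintegral_map (by fun_prop) (by fun_prop)]
  rw [h1, Measure.map_addHaar_smul _ hs.ne', lintegral_smul_measure, lintegral_add_left_eq_self,
    finrank_euclideanSpace_fin, abs_of_nonneg (by positivity), smul_eq_mul, ← mul_assoc,
    ← ENNReal.ofReal_pow hs.le, ← ENNReal.ofReal_mul (by positivity),
    mul_inv_cancel₀ (by positivity), ENNReal.ofReal_one, one_mul]

theorem enorm_sub_rpow_le_sum {F : Type*} [NormedAddCommGroup F] {p : ℝ} (hp : 1 ≤ p)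
    (f : ℕ → F) (N : ℕ) :
    ‖f 0 - f N‖ₑ ^ p ≤ (N : ℝ≥0∞) ^ (p - 1) *
      ∑ k ∈ Finset.range N, ‖f (k + 1) - f k‖ₑ ^ p := by
  have h : ‖f 0 - f N‖ₑ ≤ ∑ k ∈ Finset.range N, ‖f (k + 1) - f k‖ₑ := by
    rw [← enorm_neg, neg_sub, ← Finset.sum_range_sub]
    exact enorm_sum_le _ _
  have h2 := ENNReal.rpow_sum_le_const_mul_sum_rpow (Finset.range N)
    (fun k => ‖f (k + 1) - f k‖ₑ) hp
  rw [Finset.card_range] at h2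
  exact (ENNReal.rpow_le_rpow h (by linarith)).trans h2

/-- With `y = x + Nεξ`, the `k`-th piece joins `z = x + kεξ` to `z + εξ`, both in `A`, and `|ξ| <
r`. For fixed `ξ`, translating `x` to `z` removes the dependence on `k`. -/
theorem lintegral_step_le {d m : ℕ} {p r ε : ℝ} (hp : 1 ≤ p) (hε : 0 < ε) (k N : ℕ) (hk : k < N)
    {A S T : Set (EuclideanSpace ℝ (Fin d))} (hA : MeasurableSet A) (hS : MeasurableSet S)
    (hT : MeasurableSet T)
    (hseg : ∀ x ∈ S, ∀ y ∈ T, ∀ t ∈ Set.Icc (0 : ℝ) 1, x + t • (y - x) ∈ A)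
    (hdist : ∀ x ∈ S, ∀ y ∈ T, ‖y - x‖ < N * ε * r)
    {u : EuclideanSpace ℝ (Fin d) → EuclideanSpace ℝ (Fin m)} (hu : Measurable u) :
    ∫⁻ x in S, ∫⁻ y in T, ‖u (x + ((k + 1 : ℕ) / N : ℝ) • (y - x)) -
        u (x + ((k : ℕ) / N : ℝ) • (y - x))‖ₑ ^ p
      ≤ ENNReal.ofReal (N * ε) ^ d * (ENNReal.ofReal ε ^ p * ballConvFunctional p r ε u A) := by
  have hN : (0 : ℝ) < N := by exact_mod_cast (Nat.zero_le k).trans_lt hk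
  have hs : 0 < (N : ℝ) * ε := by positivity
  set D : EuclideanSpace ℝ (Fin d) → EuclideanSpace ℝ (Fin d) → ℝ≥0∞ :=
    fun ξ z => ‖ε⁻¹ • (u (z + ε • ξ) - u z)‖ₑ ^ p with hD
  set W : Set (EuclideanSpace ℝ (Fin d) × EuclideanSpace ℝ (Fin d)) :=
    {q | q.1 ∈ Metric.ball 0 r ∧ q.2 ∈ A ∧ q.2 + ε • q.1 ∈ A} with hW
  have hWm : MeasurableSet W :=
    (measurable_fst Metric.isOpen_ball.measurableSet).inter
      ((measurable_snd hA).inter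
        ((by fun_prop : Measurable fun q : EuclideanSpace ℝ (Fin d) × EuclideanSpace ℝ (Fin d) =>
          q.2 + ε • q.1) hA))
  have hDm : Measurable (Function.uncurry D) := by
    simp only [hD, Function.uncurry_def]
    fun_prop
  -- Extending the integrand by zero off `W` makes translation invariance on the whole space
  -- available.
  set H : EuclideanSpace ℝ (Fin d) × EuclideanSpace ℝ (Fin d) → ℝ≥0∞ :=
    W.indicator (Function.uncurry D) with hH
  have hHm : Measurable H := hDm.indicator hWm
  have hG : ∫⁻ ξ, ∫⁻ z, H (ξ, z) = ballConvFunctional p r ε u A := by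
    rw [ballConvFunctional_eq, ← lintegral_indicator Metric.isOpen_ball.measurableSet]
    refine lintegral_congr fun ξ => ?_
    by_cases hξ : ξ ∈ Metric.ball (0 : EuclideanSpace ℝ (Fin d)) r
    · have hsm : MeasurableSet (shiftDomain A ε ξ) :=
        hA.inter ((measurable_id.add_const (ε • ξ)) hA)
      rw [Set.indicator_of_mem hξ, ← lintegral_indicator hsm]
      refine lintegral_congr fun z => ?_
      by_cases hz : z ∈ shiftDomain A ε ξ
      · rw [Set.indicator_of_mem hz, hH, Set.indicator_of_mem (show (ξ, z) ∈ W from ⟨hξ, hz⟩)]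
        rfl
      · rw [Set.indicator_of_notMem hz, hH,
          Set.indicator_of_notMem (show (ξ, z) ∉ W from fun h => hz h.2)]
    · rw [Set.indicator_of_notMem hξ]
      refine (lintegral_congr fun z => ?_).trans lintegral_zero
      exact Set.indicator_of_notMem (show (ξ, z) ∉ W from fun h => hξ h.1) _
  have hpt : ∀ x ∈ S, ∫⁻ y in T, ‖u (x + ((k + 1 : ℕ) / N : ℝ) • (y - x)) -
      u (x + ((k : ℕ) / N : ℝ) • (y - x))‖ₑ ^ p ≤
      ENNReal.ofReal (N * ε) ^ d * (ENNReal.ofReal ε ^ p * ∫⁻ ξ, H (ξ, x + (k * ε) • ξ)) := by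
    intro x hx
    rw [← lintegral_indicator hT, lintegral_eq_ofReal_pow_mul_lintegral_add_smul hs x
      (Measurable.indicator (by fun_prop) hT)]
    gcongr
    rw [← lintegral_const_mul _ (by fun_prop)]
    refine lintegral_mono fun ξ => ?_
    by_cases hy : x + (N * ε) • ξ ∈ T
    · rw [Set.indicator_of_mem hy]
      have e : ∀ j : ℕ, x + ((j : ℕ) / N : ℝ) • (x + (N * ε) • ξ - x) = x + (j * ε) • ξ := by
        intro j
        rw [add_sub_cancel_left, smul_smul]
        congr 2
        field_simp
      have e1 : x + ((k + 1 : ℕ) * ε) • ξ = x + (k * ε) • ξ + ε • ξ := by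
        push_cast
        module
      have hmem : (ξ, x + (k * ε) • ξ) ∈ W := by
        refine ⟨?_, ?_, ?_⟩
        · have := hdist x hx _ hy
          rw [add_sub_cancel_left, norm_smul, Real.norm_of_nonneg hs.le] at this
          simpa using lt_of_mul_lt_mul_left this hs.le
        · have := hseg x hx _ hy (k / N) ⟨by positivity, by
            rw [div_le_one hN]; exact_mod_cast hk.le⟩
          rwa [e k] at this
        · have := hseg x hx _ hy ((k + 1 : ℕ) / N) ⟨by positivity, by
            rw [div_le_one hN]; exact_mod_cast hk⟩
          rwa [e (k + 1), e1] at this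
      rw [e, e, e1, hH, Set.indicator_of_mem hmem]
      simp only [Function.uncurry, hD]
      rw [enorm_smul, Real.enorm_eq_ofReal (by positivity), ← ENNReal.mul_rpow_of_nonneg _ _
        (by linarith), ← mul_assoc, ← ENNReal.ofReal_mul hε.le, mul_inv_cancel₀ hε.ne',
        ENNReal.ofReal_one, one_mul]
    · rw [Set.indicator_of_notMem hy]
      exact bot_le
  have hmz : Measurable fun q : EuclideanSpace ℝ (Fin d) × EuclideanSpace ℝ (Fin d) =>
      H (q.2, q.1 + (k * ε) • q.2) := by fun_prop
  calc _ ≤ ∫⁻ x in S, ENNReal.ofReal (N * ε) ^ d *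
          (ENNReal.ofReal ε ^ p * ∫⁻ ξ, H (ξ, x + (k * ε) • ξ)) :=
        setLIntegral_mono' hS hpt
    _ ≤ ∫⁻ x, ENNReal.ofReal (N * ε) ^ d *
          (ENNReal.ofReal ε ^ p * ∫⁻ ξ, H (ξ, x + (k * ε) • ξ)) := setLIntegral_le_lintegral _ _
    _ = ENNReal.ofReal (N * ε) ^ d *
          (ENNReal.ofReal ε ^ p * ∫⁻ x, ∫⁻ ξ, H (ξ, x + (k * ε) • ξ)) := by
        rw [lintegral_const_mul _ (hmz.lintegral_prod_right'.const_mul _),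
          lintegral_const_mul _ hmz.lintegral_prod_right']
    _ = _ := by
        rw [lintegral_lintegral_swap hmz.aemeasurable, ← hG]
        congr 2
        refine lintegral_congr fun ξ => ?_
        exact lintegral_add_right_eq_self (fun z => H (ξ, z)) _

/-- If all segments joining `S` to `T` lie in `A`, then dividing them into pieces of length
comparable to `ε` shows that `A` controls the pair `(S, T)`. -/
theorem PairControl.of_segment_subset {d m : ℕ} {p r : ℝ} (hp : 1 ≤ p) (hr : 0 < r)
    {A S T : Set (EuclideanSpace ℝ (Fin d))} (hA : MeasurableSet A) (hS : MeasurableSet S)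
    (hT : MeasurableSet T) (hAb : Bornology.IsBounded A)
    (hseg : ∀ x ∈ S, ∀ y ∈ T, ∀ t ∈ Set.Icc (0 : ℝ) 1, x + t • (y - x) ∈ A) :
    PairControl m p r A S T := by
  obtain ⟨R, hR⟩ := hAb.exists_norm_le
  -- `M * r` exceeds the diameter bound `2 * R`; the maximum with `0` keeps `M` positive even if `R`
  -- is negative, which is possible when `A` is empty.
  set M : ℝ := max ((2 * R + 1) / r) 0 + 1 with hM
  have hM1 : (2 * R + 1) / r < M := by
    rw [hM]; linarith [le_max_left ((2 * R + 1) / r) 0]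
  have hM0 : 0 < M := by positivity
  have hd : ∀ x ∈ S, ∀ y ∈ T, ‖y - x‖ < M * r := by
    intro x hx y hy
    have h0 := hR _ (hseg x hx y hy 0 (by simp))
    have h1 := hR _ (hseg x hx y hy 1 (by simp))
    simp only [zero_smul, add_zero, one_smul, add_sub_cancel] at h0 h1
    rw [div_lt_iff₀ hr] at hM1
    linarith [norm_sub_le y x]
  refine ⟨(Real.toNNReal (M + 1)) ^ (p + d), fun u hu ε hε hε1 => ?_⟩
  -- This gives `M ≤ N * ε ≤ M + 1`: the lower bound makes the pieces shorter than `ε * r`, the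
  -- upper one (using `ε < 1`) makes the constant uniform.
  set N : ℕ := ⌈M / ε⌉₊ with hN
  have hNM : M ≤ N * ε := by
    rw [← div_le_iff₀ hε]; exact Nat.le_ceil _
  have hNM1 : N * ε ≤ M + 1 := by
    have := (Nat.ceil_lt_add_one (show 0 ≤ M / ε by positivity)).le
    rw [← hN] at this
    have := mul_le_mul_of_nonneg_right this hε.le
    rw [add_mul, div_mul_cancel₀ _ hε.ne'] at this
    linarith
  have hN0 : (0 : ℝ) < N := by
    rw [hN]; exact_mod_cast Nat.ceil_pos.2 (by positivity)
  have hN0' : (N : ℝ≥0∞) ≠ 0 := by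
    simpa using hN0.ne'
  set G := ballConvFunctional p r ε u A
  have hmeas : ∀ k : ℕ, Measurable fun q : EuclideanSpace ℝ (Fin d) × EuclideanSpace ℝ (Fin d) =>
      ‖u (q.1 + ((k + 1 : ℕ) / N : ℝ) • (q.2 - q.1)) -
        u (q.1 + ((k : ℕ) / N : ℝ) • (q.2 - q.1))‖ₑ ^ p := fun k => by fun_prop
  calc ∫⁻ x in S, ∫⁻ y in T, ‖u x - u y‖ₑ ^ p
      ≤ ∫⁻ x in S, ∫⁻ y in T, (N : ℝ≥0∞) ^ (p - 1) * ∑ k ∈ Finset.range N,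
          ‖u (x + ((k + 1 : ℕ) / N : ℝ) • (y - x)) - u (x + ((k : ℕ) / N : ℝ) • (y - x))‖ₑ ^ p := by
        refine lintegral_mono fun x => lintegral_mono fun y => ?_
        have := enorm_sub_rpow_le_sum hp (fun j : ℕ => u (x + ((j : ℕ) / N : ℝ) • (y - x))) N
        simpa [div_self hN0.ne'] using this
    _ = (N : ℝ≥0∞) ^ (p - 1) * ∑ k ∈ Finset.range N, ∫⁻ x in S, ∫⁻ y in T,
          ‖u (x + ((k + 1 : ℕ) / N : ℝ) • (y - x)) - u (x + ((k : ℕ) / N : ℝ) • (y - x))‖ₑ ^ p := by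
        rw [← lintegral_finsetSum _ fun k _ => (hmeas k).lintegral_prod_right',
          ← lintegral_const_mul _
            (Finset.measurable_sum _ fun k _ => (hmeas k).lintegral_prod_right')]
        refine lintegral_congr fun x => ?_
        rw [lintegral_const_mul _ (by fun_prop), lintegral_finsetSum _ fun k _ => by fun_prop]
    _ ≤ (N : ℝ≥0∞) ^ (p - 1) * ∑ _k ∈ Finset.range N,
          ENNReal.ofReal (N * ε) ^ d * (ENNReal.ofReal ε ^ p * G) := by
        gcongr with k hk
        exact lintegral_step_le hp hε k N (Finset.mem_range.1 hk) hA hS hT hseg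
          (fun x hx y hy => (hd x hx y hy).trans_le (by gcongr)) hu
    -- The powers combine as `N ^ (p - 1) * N * (N * ε) ^ d * ε ^ p`.
    _ = ENNReal.ofReal (N * ε) ^ (p + d) * G := by
        rw [Finset.sum_const, Finset.card_range, nsmul_eq_mul, ← mul_assoc,
          ENNReal.rpow_add _ _ (ENNReal.ofReal_pos.2 (by positivity)).ne' ENNReal.ofReal_ne_top,
          ENNReal.rpow_natCast]
        nth_rewrite 2 [← ENNReal.rpow_one (N : ℝ≥0∞)]
        rw [← ENNReal.rpow_add _ _ hN0' (by simp), sub_add_cancel,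
          ENNReal.ofReal_mul (p := (N : ℝ)) hN0.le, ENNReal.ofReal_natCast,
          ENNReal.mul_rpow_of_nonneg _ _ (by linarith : 0 ≤ p)]
        ring
    _ ≤ _ := by
        rw [ENNReal.coe_rpow_of_nonneg _ (by positivity)]
        gcongr
        exact ENNReal.ofReal_le_ofReal hNM1

/-! ### Calculus of controlled pairs. -/

namespace PairControl

variable {d m : ℕ} {p r : ℝ} {A S T R S' T' : Set (EuclideanSpace ℝ (Fin d))}

theorem mono (h : PairControl m p r A S T) (hS : S' ⊆ S) (hT : T' ⊆ T) :
    PairControl m p r A S' T' := by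
  obtain ⟨C, hC⟩ := h
  exact ⟨C, fun u hu ε hε hε1 => le_trans ((lintegral_mono_set hS).trans
    (lintegral_mono fun x => lintegral_mono_set hT)) (hC u hu ε hε hε1)⟩

theorem symm (h : PairControl m p r A S T) : PairControl m p r A T S := by
  obtain ⟨C, hC⟩ := h
  refine ⟨C, fun u hu ε hε hε1 => le_trans (le_of_eq ?_) (hC u hu ε hε hε1)⟩
  rw [lintegral_lintegral_swap (by fun_prop)]
  refine lintegral_congr fun x => lintegral_congr fun y => ?_
  rw [← enorm_neg, neg_sub]

theorem empty_left : PairControl m p r A ∅ T := ⟨0, fun u _ ε _ _ => by simp⟩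

theorem union_left (h : PairControl m p r A S T) (h' : PairControl m p r A S' T) :
    PairControl m p r A (S ∪ S') T := by
  obtain ⟨C, hC⟩ := h
  obtain ⟨C', hC'⟩ := h'
  refine ⟨C + C', fun u hu ε hε hε1 => (lintegral_union_le _ _ _).trans ?_⟩
  rw [ENNReal.coe_add, add_mul]
  exact add_le_add (hC u hu ε hε hε1) (hC' u hu ε hε hε1)

/-- Insert `u y` between `u x` and `u z`, then average over `y ∈ T`; this is where `T` must have
positive measure. -/
theorem trans (hp : 1 ≤ p) (hT0 : volume T ≠ 0) (hS : volume S ≠ ∞) (hT : volume T ≠ ∞)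
    (hR : volume R ≠ ∞) (h : PairControl m p r A S T) (h' : PairControl m p r A T R) :
    PairControl m p r A S R := by
  obtain ⟨C, hC⟩ := h
  obtain ⟨C', hC'⟩ := h'
  set K : ℝ≥0∞ := (volume T)⁻¹ * (2 ^ (p - 1) * (volume R * C + volume S * C')) with hK
  have hKtop : K ≠ ∞ := by
    refine ENNReal.mul_ne_top (ENNReal.inv_ne_top.2 hT0) (ENNReal.mul_ne_top
      (ENNReal.rpow_ne_top_of_nonneg (by linarith) (by simp)) (ENNReal.add_ne_top.2 ⟨?_, ?_⟩))
    · exact ENNReal.mul_ne_top hR ENNReal.coe_ne_top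
    · exact ENNReal.mul_ne_top hS ENNReal.coe_ne_top
  refine ⟨K.toNNReal, fun u hu ε hε hε1 => ?_⟩
  rw [ENNReal.coe_toNNReal hKtop]
  set G := ballConvFunctional p r ε u A
  set f : EuclideanSpace ℝ (Fin d) → EuclideanSpace ℝ (Fin d) → ℝ≥0∞ :=
    fun x y => ‖u x - u y‖ₑ ^ p with hf
  have key : volume T * ∫⁻ x in S, ∫⁻ z in R, f x z ≤
      2 ^ (p - 1) * (volume R * C + volume S * C') * G := by
    calc volume T * ∫⁻ x in S, ∫⁻ z in R, f x z
        = ∫⁻ x in S, ∫⁻ _y in T, ∫⁻ z in R, f x z := by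
          simp only [lintegral_const, Measure.restrict_apply_univ]
          rw [lintegral_mul_const' _ _ hT, mul_comm]
      _ ≤ ∫⁻ x in S, ∫⁻ y in T, ∫⁻ z in R, 2 ^ (p - 1) * (f x y + f y z) := by
          refine lintegral_mono fun x => lintegral_mono fun y => lintegral_mono fun z => ?_
          refine le_trans ?_ (ENNReal.rpow_add_le_mul_rpow_add_rpow _ _ hp)
          refine ENNReal.rpow_le_rpow ?_ (by linarith)
          rw [← sub_add_sub_cancel (u x) (u y) (u z)]
          exact enorm_add_le _ _
      _ = ∫⁻ x in S, ∫⁻ y in T, 2 ^ (p - 1) * (f x y * volume R + ∫⁻ z in R, f y z) := by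
          refine lintegral_congr fun x => lintegral_congr fun y => ?_
          rw [lintegral_const_mul _ (by fun_prop), lintegral_add_left (by fun_prop),
            lintegral_const, Measure.restrict_apply_univ]
      _ = ∫⁻ x in S, 2 ^ (p - 1) * ((∫⁻ y in T, f x y) * volume R +
            ∫⁻ y in T, ∫⁻ z in R, f y z) := by
          refine lintegral_congr fun x => ?_
          rw [lintegral_const_mul' _ _ (ENNReal.rpow_ne_top_of_nonneg (by linarith) (by simp)),
            lintegral_add_left (by fun_prop), lintegral_mul_const' _ _ hR]
      _ = 2 ^ (p - 1) * ((∫⁻ x in S, ∫⁻ y in T, f x y) * volume R +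
            (∫⁻ y in T, ∫⁻ z in R, f y z) * volume S) := by
          rw [lintegral_const_mul' _ _ (ENNReal.rpow_ne_top_of_nonneg (by linarith) (by simp)),
            lintegral_add_right _ measurable_const, lintegral_mul_const' _ _ hR, lintegral_const,
            Measure.restrict_apply_univ]
      _ ≤ 2 ^ (p - 1) * (C * G * volume R + C' * G * volume S) := by
          gcongr
          · exact hC u hu ε hε hε1
          · exact hC' u hu ε hε hε1
      _ = _ := by ring
  calc ∫⁻ x in S, ∫⁻ z in R, f x z
      = (volume T)⁻¹ * (volume T * ∫⁻ x in S, ∫⁻ z in R, f x z) := by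
        rw [← mul_assoc, ENNReal.inv_mul_cancel hT0 hT, one_mul]
    _ ≤ (volume T)⁻¹ * (2 ^ (p - 1) * (volume R * C + volume S * C') * G) := by gcongr
    _ = K * G := by rw [hK]; ring

end PairControl

/-! ### Local geometry at a Lipschitz boundary. -/

/-- Near every point of its closure, an open set with Lipschitz boundary is visible from a ball
inside it. -/
theorem HasLipschitzBoundary.exists_segment_subset {d : ℕ} {A : Set (EuclideanSpace ℝ (Fin d))}
    (hA : IsOpen A) (hLip : HasLipschitzBoundary A) {x₀ : EuclideanSpace ℝ (Fin d)}
    (hx₀ : x₀ ∈ closure A) :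
    ∃ V : Set (EuclideanSpace ℝ (Fin d)), IsOpen V ∧ x₀ ∈ V ∧ ∃ c, ∃ ρ > 0,
      ∀ x ∈ V ∩ A, ∀ y ∈ Metric.ball c ρ, ∀ t ∈ Set.Icc (0 : ℝ) 1, x + t • (y - x) ∈ A := by
  by_cases hxA : x₀ ∈ A
  · obtain ⟨ρ, hρ, hb⟩ := Metric.isOpen_iff.1 hA x₀ hxA
    refine ⟨Metric.ball x₀ ρ, Metric.isOpen_ball, Metric.mem_ball_self hρ, x₀, ρ, hρ,
      fun x hx y hy t ht => hb ?_⟩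
    exact (convex_ball x₀ ρ).add_smul_sub_mem hx.1 hy ht
  obtain ⟨n, hn, K, γ, hγ, U, hU, hxU, hUA⟩ :=
    hLip x₀ (by rw [hA.frontier_eq]; exact ⟨hx₀, hxA⟩)
  obtain ⟨R, hR, hb⟩ := Metric.isOpen_iff.1 hU x₀ hxU
  set h : ℝ := R / 2 with hh
  have hK : (0 : ℝ) ≤ K := K.2
  -- Chosen so that `K * (4 * ρ) = h - 2 * ρ`: the graph's rise along the horizontal drift is at
  -- most the height gained.
  set ρ : ℝ := h / (4 * K + 2) with hρ
  have hρ0 : 0 < ρ := by positivity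
  have hρh : ρ * (4 * K + 2) = h := by rw [hρ]; field_simp
  have hρ2 : 2 * ρ ≤ h := by nlinarith
  refine ⟨Metric.ball x₀ ρ, Metric.isOpen_ball, Metric.mem_ball_self hρ0, x₀ + h • n, ρ, hρ0, ?_⟩
  rintro x ⟨hx, hxA'⟩ y hy t ⟨ht0, ht1⟩
  rw [Metric.mem_ball, dist_eq_norm] at hx hy
  -- `w` is the deviation of `y - x` from the vertical displacement `h • n`.
  obtain ⟨w, hw⟩ : ∃ w, w = (y - (x₀ + h • n)) - (x - x₀) := ⟨_, rfl⟩
  have hwn : ‖w‖ < 2 * ρ := by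
    rw [hw]; linarith [norm_sub_le (y - (x₀ + h • n)) (x - x₀)]
  have hyx : y - x = h • n + w := by rw [hw]; abel
  have hxU' : x ∈ U := hb (by rw [Metric.mem_ball, dist_eq_norm]; linarith)
  have hnn : inner ℝ n n = 1 := by rw [real_inner_self_eq_norm_sq, hn]; norm_num
  have hnw : |inner ℝ n w| ≤ ‖w‖ := by
    have := abs_real_inner_le_norm n w
    rwa [hn, one_mul] at this
  rw [hyx]
  have hzU : x + t • (h • n + w) ∈ U := by
    apply hb
    rw [Metric.mem_ball, dist_eq_norm]
    have e : x + t • (h • n + w) - x₀ = (1 - t) • (x - x₀) + t • (y - (x₀ + h • n) + h • n) := by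
      rw [hw]; module
    rw [e]
    have h1 := norm_add_le ((1 - t) • (x - x₀)) (t • (y - (x₀ + h • n) + h • n))
    have h2 := norm_add_le (y - (x₀ + h • n)) (h • n)
    rw [norm_smul, norm_smul, Real.norm_of_nonneg ht0, Real.norm_of_nonneg (by linarith)] at h1
    rw [norm_smul, hn, mul_one, Real.norm_of_nonneg (by positivity)] at h2
    nlinarith
  rw [hUA _ hzU]
  have hxγ := (hUA x hxU').1 hxA'
  have hin : inner ℝ n (x + t • (h • n + w)) = inner ℝ n x + t * (h + inner ℝ n w) := by
    rw [inner_add_right, inner_smul_right, inner_add_right, inner_smul_right, hnn, mul_one]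
  have hdist := hγ.dist_le_mul (x + t • (h • n + w) -
    inner ℝ n (x + t • (h • n + w)) • n) (x - inner ℝ n x • n)
  have e : x + t • (h • n + w) - inner ℝ n (x + t • (h • n + w)) • n - (x - inner ℝ n x • n) =
      t • (w - inner ℝ n w • n) := by
    rw [hin]; module
  have hwp : ‖w - inner ℝ n w • n‖ ≤ 4 * ρ := by
    have := norm_sub_le w (inner ℝ n w • n)
    rw [norm_smul, hn, mul_one, Real.norm_eq_abs] at this
    linarith
  rw [dist_eq_norm _ (x - inner ℝ n x • n), e, norm_smul, Real.norm_of_nonneg ht0,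
    Real.dist_eq] at hdist
  have h3 := (le_abs_self _).trans hdist
  -- The segment climbs at least as fast as the graph beneath it, so it stays strictly above.
  have h4 : (K : ℝ) * (t * ‖w - inner ℝ n w • n‖) ≤ t * (h + inner ℝ n w) := by
    have h5 := mul_le_mul_of_nonneg_left hwp hK
    have h6 := neg_le_of_abs_le hnw
    have : (K : ℝ) * ‖w - inner ℝ n w • n‖ ≤ h + inner ℝ n w := by nlinarith
    calc _ = t * ((K : ℝ) * ‖w - inner ℝ n w • n‖) := by ring
      _ ≤ _ := mul_le_mul_of_nonneg_left this ht0
  rw [hin] at h3 ⊢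
  linarith

/-! ### From local to global control. -/

/-- Two points of a connected open set have neighbourhoods which form a controlled pair. -/
theorem exists_pairControl_nhds {d m : ℕ} {p r : ℝ} (hp : 1 ≤ p) (hr : 0 < r)
    {A : Set (EuclideanSpace ℝ (Fin d))} (hA : IsOpen A) (hconn : IsPreconnected A)
    (hb : Bornology.IsBounded A) {x y : EuclideanSpace ℝ (Fin d)} (hx : x ∈ A) (hy : y ∈ A) :
    ∃ S T, IsOpen S ∧ IsOpen T ∧ x ∈ S ∧ y ∈ T ∧ S ⊆ A ∧ T ⊆ A ∧ PairControl m p r A S T := by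
  refine hconn.induction₂' (fun x y => ∃ S T, IsOpen S ∧ IsOpen T ∧ x ∈ S ∧ y ∈ T ∧ S ⊆ A ∧
    T ⊆ A ∧ PairControl m p r A S T) ?_ ?_ hx hy
  · intro x hx
    obtain ⟨ρ, hρ, hball⟩ := Metric.isOpen_iff.1 hA x hx
    have hc : PairControl m p r A (Metric.ball x ρ) (Metric.ball x ρ) :=
      .of_segment_subset hp hr hA.measurableSet Metric.isOpen_ball.measurableSet
        Metric.isOpen_ball.measurableSet hb
        fun a ha b hb t ht => hball ((convex_ball x ρ).add_smul_sub_mem ha hb ht)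
    filter_upwards [mem_nhdsWithin_of_mem_nhds (Metric.ball_mem_nhds x hρ)] with y hy
    exact ⟨⟨_, _, Metric.isOpen_ball, Metric.isOpen_ball, Metric.mem_ball_self hρ, hy, hball,
      hball, hc⟩, ⟨_, _, Metric.isOpen_ball, Metric.isOpen_ball, hy, Metric.mem_ball_self hρ,
      hball, hball, hc⟩⟩
  · rintro x y z - - - ⟨S, T, hS, hT, hxS, hyT, hSA, hTA, h⟩ ⟨T', R, hT', hR, hyT', hzR, hTA', hRA, h'⟩
    have hfin : ∀ W ⊆ A, volume W ≠ ∞ := fun W hW => (hb.subset hW).measure_lt_top.ne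
    exact ⟨S, R, hS, hR, hxS, hzR, hSA, hRA,
      PairControl.trans hp ((hT.inter hT').measure_pos _ ⟨y, hyT, hyT'⟩).ne' (hfin _ hSA)
        (hfin _ (Set.inter_subset_left.trans hTA)) (hfin _ hRA)
        (h.mono subset_rfl Set.inter_subset_left) (h'.mono Set.inter_subset_right subset_rfl)⟩

theorem pairControl_self {d m : ℕ} {p r : ℝ} (hp : 1 ≤ p) (hr : 0 < r)
    {A : Set (EuclideanSpace ℝ (Fin d))} (hA : IsOpen A) (hconn : IsConnected A)
    (hb : Bornology.IsBounded A) (hLip : HasLipschitzBoundary A) : PairControl m p r A A A := by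
  obtain ⟨a, ha⟩ := hconn.nonempty
  have hfin : ∀ W ⊆ A, volume W ≠ ∞ := fun W hW => (hb.subset hW).measure_lt_top.ne
  have hcomp : IsCompact (closure A) := hb.isCompact_closure
  -- Compactness induction against a fixed base point `a`: its neighbourhood `N` may shrink at each
  -- union, and remains open, hence of positive measure.
  obtain ⟨N, hN, haN, hNA, h⟩ : ∃ N, IsOpen N ∧ a ∈ N ∧ N ⊆ A ∧
      PairControl m p r A (closure A ∩ A) N := by
    refine hcomp.induction_on (p := fun s => ∃ N, IsOpen N ∧ a ∈ N ∧ N ⊆ A ∧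
      PairControl m p r A (s ∩ A) N) ?_ ?_ ?_ ?_
    · exact ⟨A, hA, ha, subset_rfl, by rw [Set.empty_inter]; exact .empty_left⟩
    · rintro s t hst ⟨N, hN, haN, hNA, h⟩
      exact ⟨N, hN, haN, hNA, h.mono (Set.inter_subset_inter_left _ hst) subset_rfl⟩
    · rintro s t ⟨N, hN, haN, hNA, h⟩ ⟨N', hN', haN', hNA', h'⟩
      refine ⟨N ∩ N', hN.inter hN', ⟨haN, haN'⟩, Set.inter_subset_left.trans hNA, ?_⟩
      rw [Set.union_inter_distrib_right]
      exact (h.mono subset_rfl Set.inter_subset_left).union_left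
        (h'.mono subset_rfl Set.inter_subset_right)
    · intro x hx
      obtain ⟨V, hV, hxV, c, ρ, hρ, hseg⟩ := hLip.exists_segment_subset hA hx
      refine ⟨V, mem_nhdsWithin_of_mem_nhds (hV.mem_nhds hxV), ?_⟩
      -- One point of `V ∩ A` suffices to place the ball in `A`: take the endpoints `t = 1` of its
      -- segments.
      obtain ⟨z, hz⟩ := mem_closure_iff.1 hx V hV hxV
      have hball : Metric.ball c ρ ⊆ A := fun y hy => by
        simpa using hseg z hz y hy 1 (by simp)
      have h1 : PairControl m p r A (V ∩ A) (Metric.ball c ρ) :=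
        .of_segment_subset hp hr hA.measurableSet (hV.inter hA).measurableSet
          Metric.isOpen_ball.measurableSet hb hseg
      obtain ⟨T, N, hT, hN, hcT, haN, hTA, hNA, h2⟩ := exists_pairControl_nhds (m := m) hp hr hA
        hconn.isPreconnected hb (hball (Metric.mem_ball_self hρ)) ha
      exact ⟨N, hN, haN, hNA, PairControl.trans hp
        ((Metric.isOpen_ball.inter hT).measure_pos _ ⟨c, Metric.mem_ball_self hρ, hcT⟩).ne'
        (hfin _ Set.inter_subset_right) (hfin _ (Set.inter_subset_right.trans hTA)) (hfin _ hNA)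
        (h1.mono subset_rfl Set.inter_subset_left) (h2.mono Set.inter_subset_right subset_rfl)⟩
  rw [Set.inter_eq_right.2 subset_closure] at h
  exact PairControl.trans hp (hN.measure_pos _ ⟨a, haN⟩).ne' (hfin _ subset_rfl) (hfin _ hNA)
    (hfin _ subset_rfl) h h.symm

/-! ### Passage to the average over `E`. -/

/-- Jensen's inequality, obtained from the monotonicity of `L^p` norms for the normalized measure on
`E`. -/
theorem enorm_sub_setAverage_rpow_le {α F : Type*} [MeasurableSpace α] [NormedAddCommGroup F]
    [NormedSpace ℝ F] [CompleteSpace F] {μ : Measure α} {E : Set α} {p : ℝ} (hp : 1 ≤ p)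
    (h0 : μ E ≠ 0) (hE : μ E ≠ ∞) {u : α → F} (hu : IntegrableOn u E μ) (a : F) :
    ‖a - ⨍ y in E, u y ∂μ‖ₑ ^ p ≤ (μ E)⁻¹ * ∫⁻ y in E, ‖a - u y‖ₑ ^ p ∂μ := by
  have : Fact (μ E < ∞) := ⟨hE.lt_top⟩
  have : NeZero (μ.restrict E) := ⟨by rwa [Ne, Measure.restrict_eq_zero]⟩
  have hp0 : 0 < p := by linarith
  set ν : Measure α := (μ.restrict E Set.univ)⁻¹ • μ.restrict E with hν
  have hνp : IsProbabilityMeasure ν := isProbabilityMeasureSMul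
  have huν : Integrable u ν := hu.smul_measure
    (ENNReal.inv_ne_top.2 (by rwa [Measure.restrict_apply_univ]))
  have h1 : a - ⨍ y in E, u y ∂μ = ∫ y, (a - u y) ∂ν := by
    rw [integral_sub (integrable_const a) huν, integral_const, probReal_univ, one_smul]
    rfl
  have h2 := eLpNorm'_le_eLpNorm'_of_exponent_le one_pos hp ν
    ((aestronglyMeasurable_const (b := a)).sub huν.aestronglyMeasurable)
  simp only [eLpNorm', ENNReal.rpow_one, one_div, inv_one, Pi.sub_apply] at h2
  rw [h1]
  calc _ ≤ ((∫⁻ y, ‖a - u y‖ₑ ^ p ∂ν) ^ p⁻¹) ^ p :=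
        ENNReal.rpow_le_rpow ((enorm_integral_le_lintegral_enorm _).trans h2) hp0.le
    _ = _ := by
        rw [ENNReal.rpow_inv_rpow hp0.ne', hν, lintegral_smul_measure,
          Measure.restrict_apply_univ, smul_eq_mul]

/-- Allows replacing `u` by a measurable representative, as `PairControl` requires; translations
preserve null sets. -/
theorem ballConvFunctional_congr_ae {d m : ℕ} {p r ε : ℝ}
    {A : Set (EuclideanSpace ℝ (Fin d))} (hA : MeasurableSet A)
    {u v : EuclideanSpace ℝ (Fin d) → EuclideanSpace ℝ (Fin m)}
    (h : u =ᵐ[volume.restrict A] v) :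
    ballConvFunctional p r ε u A = ballConvFunctional p r ε v A := by
  rw [ballConvFunctional_eq, ballConvFunctional_eq]
  refine lintegral_congr fun ξ => ?_
  have h' : ∀ᵐ x, x ∈ A → u x = v x := (ae_restrict_iff' hA).1 h
  have hs : ∀ᵐ x, x + ε • ξ ∈ A → u (x + ε • ξ) = v (x + ε • ξ) :=
    (measurePreserving_add_right volume (ε • ξ)).quasiMeasurePreserving.ae h'
  have hm : MeasurableSet (shiftDomain A ε ξ) :=
    hA.inter ((measurable_id.add_const (ε • ξ)) hA)
  refine setLIntegral_congr_fun_ae hm ?_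
  filter_upwards [h', hs] with x h1 h2 hx
  rw [h1 hx.1, h2 hx.2]

theorem mainTheorem10 (d m : ℕ) (p : ℝ) (hp : 1 < p) (r : ℝ) (hr : 0 < r)
    (A : Set (EuclideanSpace ℝ (Fin d))) (hA_open : IsOpen A) (hA_conn : IsConnected A)
    (hA_bdd : Bornology.IsBounded A) (hA_lip : HasLipschitzBoundary A)
    (E : Set (EuclideanSpace ℝ (Fin d))) (hE_meas : NullMeasurableSet E volume)
    (hEA : E ⊆ A) (hE_pos : 0 < volume E) :
    ∃ C : ℝ, 0 < C ∧
      ∀ u : EuclideanSpace ℝ (Fin d) → EuclideanSpace ℝ (Fin m),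
        MemLp u (ENNReal.ofReal p) (volume.restrict A) →
        ∀ ε : ℝ, 0 < ε → ε < 1 →
          ∫⁻ x in A, ‖u x - ⨍ y in E, u y‖ₑ ^ p
            ≤ ENNReal.ofReal C * ballConvFunctional p r ε u A := by
  obtain ⟨C, hC⟩ := pairControl_self (m := m) hp.le hr hA_open hA_conn hA_bdd hA_lip
  have hAfin : volume A ≠ ∞ := hA_bdd.measure_lt_top.ne
  have hEfin : volume E ≠ ∞ := (hA_bdd.subset hEA).measure_lt_top.ne
  have : Fact (volume A < ∞) := ⟨hAfin.lt_top⟩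
  set K : ℝ≥0∞ := (volume E)⁻¹ * C with hK
  have hKtop : K ≠ ∞ := ENNReal.mul_ne_top (ENNReal.inv_ne_top.2 hE_pos.ne') ENNReal.coe_ne_top
  -- The `+ 1` secures strict positivity, since `K` may vanish.
  refine ⟨K.toReal + 1, by positivity, fun u hu ε hε hε1 => ?_⟩
  obtain ⟨v, hv, huv⟩ := hu.aestronglyMeasurable
  have hvL : MemLp v (ENNReal.ofReal p) (volume.restrict A) := (memLp_congr_ae huv).1 hu
  have hvE : IntegrableOn v E volume :=
    (hvL.integrable (by rw [ENNReal.one_le_ofReal]; exact hp.le)).mono_measure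
      (Measure.restrict_mono hEA le_rfl)
  have hav : ⨍ y in E, u y = ⨍ y in E, v y :=
    average_congr (ae_restrict_of_ae_restrict_of_subset hEA huv)
  rw [hav, ballConvFunctional_congr_ae hA_open.measurableSet huv]
  calc ∫⁻ x in A, ‖u x - ⨍ y in E, v y‖ₑ ^ p
      = ∫⁻ x in A, ‖v x - ⨍ y in E, v y‖ₑ ^ p := by
        refine lintegral_congr_ae ?_
        filter_upwards [huv] with x hx
        rw [hx]
    _ ≤ ∫⁻ x in A, (volume E)⁻¹ * ∫⁻ y in A, ‖v x - v y‖ₑ ^ p := by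
        refine lintegral_mono fun x => ?_
        refine (enorm_sub_setAverage_rpow_le hp.le hE_pos.ne' hEfin hvE (v x)).trans ?_
        gcongr
    _ = (volume E)⁻¹ * ∫⁻ x in A, ∫⁻ y in A, ‖v x - v y‖ₑ ^ p :=
        lintegral_const_mul' _ _ (ENNReal.inv_ne_top.2 hE_pos.ne')
    _ ≤ (volume E)⁻¹ * (C * ballConvFunctional p r ε v A) := by
        gcongr
        exact hC v hv.measurable ε hε hε1
    _ = K * ballConvFunctional p r ε v A := by rw [hK, mul_assoc]
    _ ≤ _ := by
        gcongr
        rw [← ENNReal.ofReal_toReal hKtop]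
        exact ENNReal.ofReal_le_ofReal (by simp)
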